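/- A partition with designated summands of a nonnegative integer $m$ is an integer partition of $m$ in which, for each part size that occurs, exactly one of the occurrences of that part is designated (marked). For $k\ge 1$ let $PD_k(m)$ denote the number of partitions with designated summands of $m$ in which no part is divisible by $k$; in particular, $PD_2(m)$ counts the partitions with designated summands of $m$ all of whose parts are odd. **Theorem.** For all integers $\alpha \ge 0$ and $n \ge 0$, $$PD_2\bigl(4^\alpha(6n+5)\bigr) \equiv 0 \pmod{4}.$$ -/

import Mathlib

/-- A partition of `n` with designated summands: an integer partition of `n` together with, for
each part size `i` that occurs in it, the choice of exactly one among the `count i` occurrences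
of `i` (listed as `0, 1, …, count i - 1`), the designated one. -/
structure DesignatedPartition (n : ℕ) where
  /-- the underlying integer partition -/
  partition : n.Partition
  /-- the position of the designated occurrence of each part size -/
  designated : (i : {i : ℕ // i ∈ partition.parts}) → Fin (partition.parts.count i.1)

/-- A partition is `k`-regular if none of its parts is divisible by `k`. -/
def IsRegularPartition (k : ℕ) {n : ℕ} (p : n.Partition) : Prop :=
  ∀ i ∈ p.parts, ¬ k ∣ i

/-- There are only finitely many partitions of `n` with designated summands, so that the cardinality
in the next definition is a genuine one. -/
instance DesignatedPartition.instFinite (n : ℕ) : Finite (DesignatedPartition n) :=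
  Finite.of_injective
    (β := Σ p : n.Partition, (i : {i : ℕ // i ∈ p.parts}) → Fin (p.parts.count i.1))
    (fun d => ⟨d.partition, d.designated⟩)
    (by
      rintro ⟨p, f⟩ ⟨q, g⟩ h
      cases h
      rfl)

/-- `PD k n` is the number of `k`-regular partitions of `n` with designated summands. -/
noncomputable def PD (k n : ℕ) : ℕ :=
  Nat.card {d : DesignatedPartition n // IsRegularPartition k d.partition}

open PowerSeries Finset Filter
open scoped PowerSeries.WithPiTopology Topology

/-! Write f_k = ∏ (1 - q^(kn)). Each odd part size contributes 1 + x + 2x² + 3x³ + ⋯ without the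
repeated linear term, that is 1 + ∑ j x^j = (1 - x + x²)/(1 - x)², so the generating function is F =
f_4 f_6² / (f_1 f_3 f_12). By Gauss's ψ = f_2²/f_1, this is f_4/(f_2² f_12) · ψ(q)ψ(q³), and
ψ(q)ψ(q³) has an explicit 2-dissection. Modulo 4 one has f_k⁴ = f_(2k)², φ² = 1 and φ = f_2/f_1²,
which turn the dissection into F = F(q²)² + q f_6⁴ (`designatedOddSeries_eq`). The odd part q f_6⁴
lives on exponents 1 mod 6, which settles 6n + 5. Moreover F⁴ = F(q²)²
(`designatedOddSeries_pow_four`), so the even part of F² is again F: two bisections give PD_2(4n) ≡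
PD_2(n), and induction on α finishes. -/

/-- The power series whose coefficient at `n` is the number of indices `i` with `e i = n`. -/
noncomputable def fiberSeries (R : Type*) [CommRing R] {ι : Type*} (e : ι → ℕ) : R⟦X⟧ :=
  PowerSeries.mk fun n => (Nat.card {i // e i = n} : R)

/-! ### Calculus of series that count indices by weight -/

section fiberSeries

variable {R : Type*} [CommRing R] {ι κ : Type*}

theorem coeff_fiberSeries (e : ι → ℕ) (n : ℕ) :
    (fiberSeries R e).coeff n = (Nat.card {i // e i = n} : R) :=
  coeff_mk _ _

theorem fiberSeries_comp_equiv (σ : κ ≃ ι) (e : ι → ℕ) (e' : κ → ℕ) (h : ∀ k, e' k = e (σ k)) :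
    fiberSeries R e' = fiberSeries R e := by
  ext n
  rw [coeff_fiberSeries, coeff_fiberSeries]
  congr 1
  exact Nat.card_congr (σ.subtypeEquiv fun k => by rw [h])

/-- Finite fibres are assumed because `Nat.card` is 0 on infinite types. -/
theorem fiberSeries_sumElim (e : ι → ℕ) (e' : κ → ℕ) (he : ∀ n, Finite {i // e i = n})
    (he' : ∀ n, Finite {i // e' i = n}) :
    fiberSeries R (Sum.elim e e') = fiberSeries R e + fiberSeries R e' := by
  ext n
  rw [map_add, coeff_fiberSeries, coeff_fiberSeries, coeff_fiberSeries, ← Nat.cast_add]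
  have := he n
  have := he' n
  rw [← Nat.card_sum]
  congr 1
  exact Nat.card_congr (Equiv.subtypeSum (p := fun c => Sum.elim e e' c = n))

/-- Pairs with prescribed total weight, sorted by their two weights. -/
def fiberAddEquiv (e : ι → ℕ) (e' : κ → ℕ) (n : ℕ) :
    {x : ι × κ // e x.1 + e' x.2 = n} ≃
      Σ p : antidiagonal n, {i // e i = p.1.1} × {j // e' j = p.1.2} where
  toFun x := ⟨⟨(e x.1.1, e' x.1.2), mem_antidiagonal.2 x.2⟩, ⟨x.1.1, rfl⟩, ⟨x.1.2, rfl⟩⟩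
  invFun y := ⟨(y.2.1.1, y.2.2.1), by
    rw [y.2.1.2, y.2.2.2]; exact mem_antidiagonal.1 y.1.2⟩
  left_inv _ := rfl
  right_inv := by
    rintro ⟨⟨⟨a, b⟩, h⟩, ⟨i, hi⟩, ⟨j, hj⟩⟩
    dsimp only at hi hj
    subst hi hj
    rfl

theorem fiberSeries_mul (e : ι → ℕ) (e' : κ → ℕ) (he : ∀ n, Finite {i // e i = n})
    (he' : ∀ n, Finite {i // e' i = n}) :
    fiberSeries R e * fiberSeries R e' = fiberSeries R fun x : ι × κ => e x.1 + e' x.2 := by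
  ext n
  rw [coeff_mul, coeff_fiberSeries, Nat.card_congr (fiberAddEquiv e e' n), Nat.card_sigma,
    ← Finset.sum_coe_sort (antidiagonal n), Nat.cast_sum]
  refine Finset.sum_congr rfl fun p _ => ?_
  rw [coeff_fiberSeries, coeff_fiberSeries, Nat.card_prod, Nat.cast_mul]

theorem expand_fiberSeries (k : ℕ) (hk : k ≠ 0) (e : ι → ℕ) :
    expand k hk (fiberSeries R e) = fiberSeries R fun i => k * e i := by
  ext n
  rw [coeff_expand, coeff_fiberSeries]
  split_ifs with h
  · obtain ⟨m, rfl⟩ := h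
    rw [Nat.mul_div_cancel_left _ (Nat.pos_of_ne_zero hk), coeff_fiberSeries]
    congr 1
    exact Nat.card_congr (Equiv.subtypeEquivRight fun i => (Nat.mul_right_inj hk).symm)
  · have : IsEmpty {i // k * e i = n} := ⟨fun i => h ⟨_, i.2.symm⟩⟩
    rw [coeff_fiberSeries, Nat.card_of_isEmpty, Nat.cast_zero]

theorem X_mul_fiberSeries (e : ι → ℕ) :
    X * fiberSeries R e = fiberSeries R fun i => e i + 1 := by
  ext n
  cases n with
  | zero => simp [coeff_fiberSeries]
  | succ n => simp [coeff_succ_X_mul, coeff_fiberSeries]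

end fiberSeries

/-! ### Theta functions φ and ψ and their dissections -/

/-- The exponents `n (2 n + 1)`, `n ∈ ℤ`, which are the triangular numbers. -/
def psiExponent (n : ℤ) : ℕ := (n * (2 * n + 1)).toNat

theorem psiExponent_cast (n : ℤ) : (psiExponent n : ℤ) = n * (2 * n + 1) := by
  apply Int.toNat_of_nonneg
  rcases le_or_gt 0 n with h | h
  · positivity
  · exact mul_nonneg_of_nonpos_of_nonpos h.le (by omega)

theorem finite_fiber_of_natAbs_le {e : ℤ → ℕ} (h : ∀ n, n.natAbs ≤ e n) (d : ℕ) :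
    Finite {i // e i = d} := by
  refine Set.Finite.subset (Set.finite_Icc (-(d : ℤ)) d) fun i (hi : e i = d) => ?_
  have := h i
  rw [Set.mem_Icc]
  omega

theorem natAbs_le_psiExponent (n : ℤ) : n.natAbs ≤ psiExponent n := by
  zify
  rw [psiExponent_cast]
  rcases le_or_gt 0 n with h | h
  · rw [abs_of_nonneg h]; nlinarith
  · rw [abs_of_neg h]; nlinarith

theorem natAbs_le_natAbs_sq (n : ℤ) : n.natAbs ≤ n.natAbs ^ 2 :=
  Nat.le_self_pow two_ne_zero _

/-- Ramanujan's theta function `ψ`. -/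
noncomputable def psiSeries (R : Type*) [CommRing R] : R⟦X⟧ := fiberSeries R psiExponent

/-- Ramanujan's theta function `φ`. -/
noncomputable def phiSeries (R : Type*) [CommRing R] : R⟦X⟧ :=
  fiberSeries R fun n : ℤ => n.natAbs ^ 2

/-- The change of variables behind `ψ(q)² = φ(q) ψ(q²)`. -/
def psiSqEquiv : ℤ × ℤ ≃ ℤ × ℤ where
  -- Complete squares: 8n(2n+1) + 1 = a² with a = 4n+1, likewise b = 4m+1, and 2(a² + b²) = (a-b)² +
  -- (a+b)². Here a - b = 4k, and the odd number (a+b)/2 is ±(4j+1); the `if` picks the sign.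
  toFun x := (x.1 - x.2,
    if (x.1 + x.2) % 2 = 0 then (x.1 + x.2) / 2 else (-1 - (x.1 + x.2)) / 2)
  invFun y := if y.1 % 2 = 0 then (y.2 + y.1 / 2, y.2 - y.1 / 2)
    else ((y.1 - 1) / 2 - y.2, (-1 - y.1) / 2 - y.2)
  left_inv := by
    rintro ⟨n, m⟩
    ext <;> dsimp only <;> split_ifs <;> dsimp only <;> omega
  right_inv := by
    rintro ⟨k, j⟩
    by_cases h : k % 2 = 0 <;> simp only [h, if_true, if_false]
    · rw [if_pos (by omega)]
      congr 1 <;> omega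
    · rw [if_neg (by omega)]
      congr 1 <;> omega

/-- The change of variables behind `ψ(q) ψ(q³) = φ(q⁶) ψ(q⁴) + q φ(q²) ψ(q¹²)`. -/
def psiMulEquiv : ℤ × ℤ ≃ (ℤ × ℤ) ⊕ (ℤ × ℤ) where
  toFun x :=
    -- With a = 4n+1 and b = 4m+1, use 4(a² + 3b²) = (a+3b)² + 3(a-b)², where a - b = 4(n-m) and a +
    -- 3b = 4(n+3m+1). Exactly one of n-m and n+3m+1 is even, giving 2k; the other is ±(4j+1), and
    -- the inner `if` picks the sign.
    if (x.1 - x.2) % 2 = 0 then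
      .inl ((x.1 - x.2) / 2,
        if (x.1 + 3 * x.2) % 4 = 0 then (x.1 + 3 * x.2) / 4 else (-2 - (x.1 + 3 * x.2)) / 4)
    else
      .inr ((x.1 + 3 * x.2 + 1) / 2,
        if (x.1 - x.2) % 4 = 1 then (x.1 - x.2 - 1) / 4 else (-1 - (x.1 - x.2)) / 4)
  invFun := Sum.elim
    (fun y => if y.1 % 2 = 0 then (y.2 + 3 * (y.1 / 2), y.2 - y.1 / 2)
      else ((3 * y.1 - 1) / 2 - y.2, (-1 - y.1) / 2 - y.2))
    (fun y => if y.1 % 2 = 0 then (y.1 / 2 - 3 * y.2 - 1, y.1 / 2 + y.2)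
      else ((y.1 - 1) / 2 + 3 * y.2 + 1, (y.1 - 1) / 2 - y.2))
  left_inv := by
    rintro ⟨n, m⟩
    dsimp only
    by_cases h : (n - m) % 2 = 0
    · rw [if_pos h]
      ext <;> dsimp only [Sum.elim_inl] <;> split_ifs <;> dsimp only <;> omega
    · rw [if_neg h]
      ext <;> dsimp only [Sum.elim_inr] <;> split_ifs <;> dsimp only <;> omega
  right_inv := by
    rintro (⟨k, j⟩ | ⟨k, j⟩)
    · by_cases h : k % 2 = 0 <;> simp only [Sum.elim_inl, h, if_true, if_false]
      · rw [if_pos (by omega), if_pos (by omega)]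
        congr 2 <;> omega
      · rw [if_pos (by omega), if_neg (by omega)]
        congr 2 <;> omega
    · by_cases h : k % 2 = 0 <;> simp only [Sum.elim_inr, h, if_true, if_false]
      · rw [if_neg (by omega), if_neg (by omega)]
        congr 2 <;> omega
      · rw [if_neg (by omega), if_pos (by omega)]
        congr 2 <;> omega

theorem psiSeries_sq (R : Type*) [CommRing R] :
    psiSeries R ^ 2 = phiSeries R * expand 2 two_ne_zero (psiSeries R) := by
  have h : ∀ d, Finite {i // 2 * psiExponent i = d} :=
    finite_fiber_of_natAbs_le fun n => by have := natAbs_le_psiExponent n; omega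
  rw [sq, psiSeries, phiSeries, expand_fiberSeries,
    fiberSeries_mul _ _ (finite_fiber_of_natAbs_le natAbs_le_psiExponent)
      (finite_fiber_of_natAbs_le natAbs_le_psiExponent),
    fiberSeries_mul _ _ (finite_fiber_of_natAbs_le natAbs_le_natAbs_sq) h]
  refine fiberSeries_comp_equiv psiSqEquiv _ _ ?_
  rintro ⟨n, m⟩
  zify
  simp only [psiExponent_cast, psiSqEquiv, Equiv.coe_fn_mk, sq_abs]
  split_ifs with h
  · obtain ⟨j, hj⟩ := Int.dvd_of_emod_eq_zero h
    rw [hj, Int.mul_ediv_cancel_left _ two_ne_zero]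
    obtain rfl : n = 2 * j - m := by omega
    ring
  · obtain ⟨j, hj⟩ : (2 : ℤ) ∣ -1 - (n + m) := by omega
    rw [hj, Int.mul_ediv_cancel_left _ two_ne_zero]
    obtain rfl : n = -1 - 2 * j - m := by omega
    ring

theorem psiSeries_mul_expand_three (R : Type*) [CommRing R] :
    psiSeries R * expand 3 three_ne_zero (psiSeries R) =
      expand 6 (by norm_num) (phiSeries R) * expand 4 four_ne_zero (psiSeries R) +
      X * (expand 2 two_ne_zero (phiSeries R) * expand 12 (by norm_num) (psiSeries R)) := by
  have h (k : ℕ) (hk : 0 < k) : ∀ d, Finite {i // k * psiExponent i = d} :=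
    finite_fiber_of_natAbs_le fun n => by
      have := natAbs_le_psiExponent n; nlinarith
  have h' (k : ℕ) (hk : 0 < k) : ∀ d, Finite {i : ℤ // k * i.natAbs ^ 2 = d} :=
    finite_fiber_of_natAbs_le fun n => by
      have := natAbs_le_natAbs_sq n; nlinarith
  have hadd (k l : ℕ) (hk : 0 < k) (hl : 0 < l) (d : ℕ) :
      Finite {x : ℤ × ℤ // k * x.1.natAbs ^ 2 + l * psiExponent x.2 = d} := by
    have : (Set.Icc (-(d : ℤ)) d ×ˢ Set.Icc (-(d : ℤ)) d).Finite :=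
      (Set.finite_Icc _ _).prod (Set.finite_Icc _ _)
    refine this.subset fun x (hx : _ = d) => ?_
    have h1 := natAbs_le_psiExponent x.2
    have h2 := natAbs_le_natAbs_sq x.1
    have h3 : x.2.natAbs ≤ d := by nlinarith
    have h4 : x.1.natAbs ≤ d := by nlinarith
    simp only [Set.mem_prod, Set.mem_Icc]
    omega
  have hadd' (d : ℕ) :
      Finite {x : ℤ × ℤ // 2 * x.1.natAbs ^ 2 + 12 * psiExponent x.2 + 1 = d} := by
    cases d with
    | zero => exact Set.finite_empty.subset fun x (hx : _ + 1 = 0) => absurd hx (by omega)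
    | succ d => simpa using hadd 2 12 (by norm_num) (by norm_num) d
  simp only [psiSeries, phiSeries, expand_fiberSeries]
  rw [fiberSeries_mul _ _ (finite_fiber_of_natAbs_le natAbs_le_psiExponent) (h 3 (by norm_num)),
    fiberSeries_mul _ _ (h' 6 (by norm_num)) (h 4 (by norm_num)),
    fiberSeries_mul _ _ (h' 2 (by norm_num)) (h 12 (by norm_num)), X_mul_fiberSeries,
    ← fiberSeries_sumElim _ _ (hadd 6 4 (by norm_num) (by norm_num))
      (fun d => hadd' d)]
  refine fiberSeries_comp_equiv psiMulEquiv _ _ ?_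
  rintro ⟨n, m⟩
  simp only [psiMulEquiv, Equiv.coe_fn_mk]
  split_ifs with h1 h2 h2 <;> simp only [Sum.elim_inl, Sum.elim_inr] <;> zify <;>
    simp only [psiExponent_cast, sq_abs]
  · obtain ⟨j, hj⟩ := Int.dvd_of_emod_eq_zero h2
    obtain ⟨k, hk⟩ := Int.dvd_of_emod_eq_zero h1
    rw [hj, hk, Int.mul_ediv_cancel_left _ two_ne_zero, Int.mul_ediv_cancel_left _ four_ne_zero]
    obtain rfl : n = 2 * k + m := by omega
    obtain rfl : k = 2 * (j - m) := by omega
    ring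
  · obtain ⟨j, hj⟩ : (4 : ℤ) ∣ -2 - (n + 3 * m) := by omega
    obtain ⟨k, hk⟩ := Int.dvd_of_emod_eq_zero h1
    rw [hj, hk, Int.mul_ediv_cancel_left _ two_ne_zero, Int.mul_ediv_cancel_left _ four_ne_zero]
    obtain rfl : n = 2 * k + m := by omega
    obtain rfl : k = -1 - 2 * j - 2 * m := by omega
    ring
  · obtain ⟨j, hj⟩ : (4 : ℤ) ∣ n - m - 1 := by omega
    obtain ⟨k, hk⟩ : (2 : ℤ) ∣ n + 3 * m + 1 := by omega
    rw [hj, hk, Int.mul_ediv_cancel_left _ two_ne_zero, Int.mul_ediv_cancel_left _ four_ne_zero]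
    obtain rfl : n = 4 * j + m + 1 := by omega
    obtain rfl : k = 2 * j + 2 * m + 1 := by omega
    ring
  · obtain ⟨j, hj⟩ : (4 : ℤ) ∣ -1 - (n - m) := by omega
    obtain ⟨k, hk⟩ : (2 : ℤ) ∣ n + 3 * m + 1 := by omega
    rw [hj, hk, Int.mul_ediv_cancel_left _ two_ne_zero, Int.mul_ediv_cancel_left _ four_ne_zero]
    obtain rfl : n = m - 1 - 4 * j := by omega
    obtain rfl : k = 2 * m - 2 * j := by omega
    ring

/-- The exponents of `ψ` listed as the triangular numbers. -/
theorem psiSeries_eq_triangular (R : Type*) [CommRing R] :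
    psiSeries R = fiberSeries R fun s : ℕ => s * (s + 1) / 2 := by
  -- This bijection sends n ≥ 0 to 2n and -(n+1) to 2n+1.
  refine fiberSeries_comp_equiv Equiv.intEquivNat _ _ fun n => ?_
  symm
  apply Nat.div_eq_of_eq_mul_left two_pos
  zify
  rw [psiExponent_cast]
  cases n with
  | ofNat n =>
    change ((2 * n : ℕ) : ℤ) * ((2 * n : ℕ) + 1) = _
    push_cast
    rw [Int.ofNat_eq_natCast]
    ring
  | negSucc n =>
    change ((2 * n + 1 : ℕ) : ℤ) * ((2 * n + 1 : ℕ) + 1) = _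
    push_cast [Int.negSucc_eq]
    ring

/-- Integers are zero, positive or negative. -/
def intEquivZeroPosNeg : ℤ ≃ Unit ⊕ (ℕ ⊕ ℕ) where
  toFun
    | 0 => .inl ()
    | Int.ofNat (n + 1) => .inr (.inl n)
    | Int.negSucc n => .inr (.inr n)
  invFun
    | .inl _ => 0
    | .inr (.inl n) => Int.ofNat (n + 1)
    | .inr (.inr n) => Int.negSucc n
  left_inv
    | 0 => rfl
    | Int.ofNat (_ + 1) => rfl
    | Int.negSucc _ => rfl
  right_inv
    | .inl _ => rfl
    | .inr (.inl _) => rfl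
    | .inr (.inr _) => rfl

theorem phiSeries_eq_one_add (R : Type*) [CommRing R] :
    phiSeries R = 1 + 2 * fiberSeries R fun n : ℕ => (n + 1) ^ 2 := by
  have hfin (d : ℕ) : Finite {n : ℕ // (n + 1) ^ 2 = d} :=
    (Set.finite_Iic d).subset fun n (hn : (n + 1) ^ 2 = d) => by
      rw [Set.mem_Iic]; nlinarith
  have hfin' (d : ℕ) :
      Finite {x : ℕ ⊕ ℕ // Sum.elim (fun n => (n + 1) ^ 2) (fun n => (n + 1) ^ 2) x = d} :=
    have : Finite ({n : ℕ // (n + 1) ^ 2 = d} ⊕ {n : ℕ // (n + 1) ^ 2 = d}) :=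
      have := hfin d
      inferInstance
    (Equiv.finite_iff Equiv.subtypeSum).2 this
  have hone : fiberSeries R (fun _ : Unit => 0) = 1 := by
    ext n
    rw [coeff_fiberSeries, coeff_one]
    split_ifs with h
    · simp [h]
    · simp [Ne.symm h]
  rw [two_mul, ← fiberSeries_sumElim _ _ hfin hfin, ← hone,
    ← fiberSeries_sumElim _ _ (fun _ => inferInstance) hfin']
  refine fiberSeries_comp_equiv intEquivZeroPosNeg _ _ ?_
  rintro ((_ | n) | n) <;> rfl

/-- `φ² ≡ 1` modulo `4`. -/
theorem phiSeries_sq_eq_one {R : Type*} [CommRing R] (h4 : (4 : R⟦X⟧) = 0) :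
    phiSeries R ^ 2 = 1 := by
  rw [phiSeries_eq_one_add]
  set g := fiberSeries R fun n : ℕ => (n + 1) ^ 2
  linear_combination (g + g ^ 2) * h4

/-! ### Gauss's product for ψ and infinite products -/

/-- A finite form of Gauss's product formula for the generating series of the triangular
numbers, after Shanks. -/
theorem sum_prod_mul_pow_eq_prod_mul_sum {R : Type*} [CommRing R] (q : R) (n : ℕ) :
    ∑ s ∈ range n, (∏ j ∈ Ico s n, (1 - q ^ (2 * j + 2))) * (∏ j ∈ range s, (1 - q ^ (2 * j + 1))) *
        q ^ (s * (2 * n + 1)) =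
      (∏ j ∈ range n, (1 - q ^ (2 * j + 1))) * ∑ s ∈ range (2 * n), q ^ (s * (s + 1) / 2) := by
  induction n with
  | zero => simp
  | succ n ih =>
    have tri₁ : 2 * n * (2 * n + 1) / 2 = n * (2 * n + 1) := by
      rw [mul_assoc, Nat.mul_div_cancel_left _ two_pos]
    have tri₂ : (2 * n + 1) * (2 * n + 1 + 1) / 2 = n * (2 * n + 1) + (2 * n + 1) := by
      rw [show (2 * n + 1) * (2 * n + 1 + 1) = 2 * ((2 * n + 1) * (n + 1)) by ring,
        Nat.mul_div_cancel_left _ two_pos]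
      ring
    let A : ℕ → R := fun s => ∏ j ∈ range s, (1 - q ^ (2 * j + 1))
    let B : ℕ → ℕ → R := fun s m => ∏ j ∈ Ico s m, (1 - q ^ (2 * j + 2))
    change ∑ s ∈ range n, B s n * A s * q ^ (s * (2 * n + 1)) = A n * _ at ih
    change ∑ s ∈ range (n + 1), B s (n + 1) * A s * q ^ (s * (2 * (n + 1) + 1)) = A (n + 1) * _
    -- Telescoping certificate: passing from n to n+1 changes the s-th summand, up to the new factor
    -- 1 - q^(2n+1), by v (s+1) - v s.
    let v : ℕ → R := fun s => (1 - q ^ (2 * s)) * B s n * A s * q ^ (s * (2 * n + 1))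
    have hAs (s : ℕ) : A (s + 1) = A s * (1 - q ^ (2 * s + 1)) := prod_range_succ _ _
    have key : ∀ s ∈ range n, B s (n + 1) * A s * q ^ (s * (2 * (n + 1) + 1)) -
        (1 - q ^ (2 * n + 1)) * (B s n * A s * q ^ (s * (2 * n + 1))) = v (s + 1) - v s := by
      intro s hs
      have hs' := mem_range.1 hs
      have h1 : B s (n + 1) = B s n * (1 - q ^ (2 * n + 2)) := prod_Ico_succ_top hs'.le _
      have h2 : B s n = (1 - q ^ (2 * s + 2)) * B (s + 1) n := prod_eq_prod_Ico_succ_bot hs' _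
      simp only [v]
      rw [h1, h2, hAs]
      ring
    have tele := sum_congr rfl key
    rw [sum_range_sub, sum_sub_distrib, ← mul_sum, ih] at tele
    have hv0 : v 0 = 0 := by simp [v]
    have hvn : v n = (1 - q ^ (2 * n)) * A n * q ^ (n * (2 * n + 1)) := by simp [v, B]
    have hBn : B n (n + 1) = 1 - q ^ (2 * n + 2) := by simp [B]
    rw [sum_range_succ, hBn, show 2 * (n + 1) = 2 * n + 1 + 1 by ring, sum_range_succ,
      sum_range_succ, tri₁, tri₂, hAs]
    rw [hv0, hvn, show 2 * (n + 1) = 2 * n + 1 + 1 by ring] at tele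
    linear_combination tele

theorem triangular_fiberSeries_sub_sum_dvd (R : Type*) [CommRing R] (n : ℕ) :
    (X : R⟦X⟧) ^ n ∣ (fiberSeries R fun s : ℕ => s * (s + 1) / 2) -
      ∑ s ∈ range n, X ^ (s * (s + 1) / 2) := by
  rw [X_pow_dvd_iff]
  intro m hm
  have hle (s : ℕ) : s ≤ s * (s + 1) / 2 := by
    rw [Nat.le_div_iff_mul_le two_pos]
    rcases s.eq_zero_or_pos with rfl | h
    · simp
    · nlinarith
  rw [map_sub, coeff_fiberSeries, map_sum, sub_eq_zero]
  simp only [coeff_X_pow]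
  rw [Finset.sum_boole, Nat.subtype_card]
  intro s
  rw [mem_filter, mem_range, eq_comm]
  refine and_iff_right_of_imp fun h => ?_
  have := hle s
  omega

section products

variable {R : Type*} [CommRing R] [TopologicalSpace R]

theorem continuous_expand (p : ℕ) (hp : p ≠ 0) :
    Continuous (expand p hp : R⟦X⟧ →ₐ[R] R⟦X⟧) := by
  rw [continuous_iff_continuousAt]
  intro f
  rw [ContinuousAt, WithPiTopology.tendsto_iff_coeff_tendsto]
  intro d
  simp only [coeff_expand]
  split_ifs
  · exact (WithPiTopology.continuous_coeff R _).continuousAt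
  · exact tendsto_const_nhds

theorem multipliable_one_sub_X_pow_of_le {e : ℕ → ℕ} (he : ∀ n, n < e n) :
    Multipliable fun n => (1 : R⟦X⟧) - X ^ e n := by
  nontriviality R
  simp_rw [sub_eq_add_neg]
  apply WithPiTopology.multipliable_one_add_of_tendsto_order_atTop_nhds_top
  refine ENat.tendsto_nhds_top_iff_natCast_lt.mpr fun n => eventually_atTop.mpr ⟨n, ?_⟩
  intro m hm
  rw [order_neg, order_X_pow]
  exact_mod_cast hm.trans_lt (he m)

/-- The product `∏ (1 - q ^ (k n))` over `n ≥ 1`. -/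
noncomputable def eulerProduct (R : Type*) [CommRing R] [TopologicalSpace R] (k : ℕ) : R⟦X⟧ :=
  ∏' n : ℕ, (1 - X ^ (k * (n + 1)))

/-- The product `∏ (1 - q ^ (k n))` over odd `n ≥ 1`. -/
noncomputable def oddEulerProduct (R : Type*) [CommRing R] [TopologicalSpace R] (k : ℕ) : R⟦X⟧ :=
  ∏' n : ℕ, (1 - X ^ (k * (2 * n + 1)))

theorem multipliable_eulerProduct {k : ℕ} (hk : k ≠ 0) :
    Multipliable fun n : ℕ => (1 : R⟦X⟧) - X ^ (k * (n + 1)) :=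
  multipliable_one_sub_X_pow_of_le fun n => by
    have := Nat.pos_of_ne_zero hk
    nlinarith

theorem multipliable_oddEulerProduct {k : ℕ} (hk : k ≠ 0) :
    Multipliable fun n : ℕ => (1 : R⟦X⟧) - X ^ (k * (2 * n + 1)) :=
  multipliable_one_sub_X_pow_of_le fun n => by
    have := Nat.pos_of_ne_zero hk
    nlinarith

variable [T2Space R]

theorem expand_eulerProduct (p : ℕ) (hp : p ≠ 0) {k : ℕ} (hk : k ≠ 0) :
    expand p hp (eulerProduct R k) = eulerProduct R (p * k) := by
  rw [eulerProduct, (multipliable_eulerProduct hk).map_tprod _ (continuous_expand p hp)]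
  simp [eulerProduct, mul_assoc, pow_mul]

theorem isUnit_eulerProduct {k : ℕ} (hk : k ≠ 0) : IsUnit (eulerProduct R k) := by
  rw [isUnit_iff_constantCoeff, eulerProduct, (multipliable_eulerProduct hk).map_tprod _
    (WithPiTopology.continuous_constantCoeff R)]
  simp [hk]

variable [IsTopologicalRing R]

theorem eulerProduct_eq_odd_mul {k : ℕ} (hk : k ≠ 0) :
    eulerProduct R k = oddEulerProduct R k * eulerProduct R (2 * k) := by
  have h : (fun n : ℕ => (1 : R⟦X⟧) - X ^ (k * (2 * n + 1 + 1))) =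
      fun n => 1 - X ^ (2 * k * (n + 1)) := by
    ext1 n
    ring_nf
  have heven : Multipliable fun n : ℕ => (1 : R⟦X⟧) - X ^ (k * (2 * n + 1 + 1)) := by
    rw [h]
    exact multipliable_eulerProduct (mul_ne_zero two_ne_zero hk)
  have := tprod_even_mul_odd (f := fun n : ℕ => (1 : R⟦X⟧) - X ^ (k * (n + 1)))
    (multipliable_oddEulerProduct hk) heven
  rw [h] at this
  exact this.symm

/-- Gauss: `ψ(q) = (q²; q²)_∞ / (q; q²)_∞`. -/
theorem oddEulerProduct_mul_psiSeries :
    oddEulerProduct R 1 * psiSeries R = eulerProduct R 2 := by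
  have hodd := (multipliable_oddEulerProduct (R := R) one_ne_zero).hasProd.tendsto_prod_nat
  have heven := (multipliable_eulerProduct (R := R) two_ne_zero).hasProd.tendsto_prod_nat
  refine tendsto_nhds_unique (hodd.mul_const (psiSeries R)) ?_
  have hlim : Tendsto (fun n => (∏ j ∈ range n, ((1 : R⟦X⟧) - X ^ (1 * (2 * j + 1)))) *
      psiSeries R - ∏ j ∈ range n, (1 - X ^ (2 * (j + 1)))) atTop (𝓝 0) := by
    rw [WithPiTopology.tendsto_iff_coeff_tendsto]
    intro d
    refine tendsto_atTop_of_eventually_const (i₀ := d + 1) fun n hn => ?_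
    rw [map_zero]
    refine X_pow_dvd_iff.1 ?_ d (show d < n by omega)
    have hsh := sum_prod_mul_pow_eq_prod_mul_sum (X : R⟦X⟧) n
    have hdvd := (pow_dvd_pow (X : R⟦X⟧) (show n ≤ 2 * n by omega)).trans
      (triangular_fiberSeries_sub_sum_dvd R (2 * n))
    rw [← psiSeries_eq_triangular] at hdvd
    obtain ⟨m, rfl⟩ : ∃ m, n = m + 1 := ⟨n - 1, by omega⟩
    -- Only the s = 0 term survives modulo X^n, and it is the partial product of f_2.
    rw [sum_range_succ', ← range_eq_Ico] at hsh
    have hsum : (X : R⟦X⟧) ^ (m + 1) ∣ ∑ s ∈ range m,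
        (∏ j ∈ Ico (s + 1) (m + 1), (1 - X ^ (2 * j + 2))) *
          (∏ j ∈ range (s + 1), (1 - X ^ (2 * j + 1))) * X ^ ((s + 1) * (2 * (m + 1) + 1)) :=
      dvd_sum fun s _ => (pow_dvd_pow _ (by nlinarith)).mul_left _
    have := (hdvd.mul_left (∏ j ∈ range (m + 1), (1 - X ^ (2 * j + 1)))).add hsum
    convert this using 1
    simp only [one_mul, mul_add, mul_one, range_zero, prod_empty, zero_mul] at hsh ⊢
    linear_combination -hsh
  simpa [eulerProduct] using hlim.add heven

theorem psiSeries_mul_eulerProduct :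
    psiSeries R * eulerProduct R 1 = eulerProduct R 2 ^ 2 := by
  rw [eulerProduct_eq_odd_mul one_ne_zero, ← mul_assoc, mul_comm (psiSeries R),
    oddEulerProduct_mul_psiSeries, mul_one, sq]

/-- Factor by factor, (1-x)⁴ ≡ (1-x²)² modulo 4. -/
theorem eulerProduct_pow_four (h4 : (4 : R⟦X⟧) = 0) {k : ℕ} (hk : k ≠ 0) :
    eulerProduct R k ^ 4 = eulerProduct R (2 * k) ^ 2 := by
  rw [eulerProduct, eulerProduct, ← (multipliable_eulerProduct hk).tprod_pow,
    ← (multipliable_eulerProduct (mul_ne_zero two_ne_zero hk)).tprod_pow]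
  refine tprod_congr fun n => ?_
  rw [mul_assoc, mul_comm 2, pow_mul]
  set x := (X : R⟦X⟧) ^ (k * (n + 1))
  linear_combination (-x + 2 * x ^ 2 - x ^ 3) * h4

end products

/-! ### The generating function as an eta quotient -/

/-- Designating summands multiplies the count by the multiplicity of each part size; the value 0 at
multiples of k kills the non-regular partitions. This is the shape required by
`Nat.Partition.genFun`. -/
theorem PD_eq_sum (k n : ℕ) :
    PD k n = ∑ p : n.Partition, p.parts.toFinsupp.prod fun i c => if k ∣ i then 0 else c := by
  classical
  let e : {d : DesignatedPartition n // IsRegularPartition k d.partition} ≃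
      Σ p : {p : n.Partition // IsRegularPartition k p},
        (i : {i : ℕ // i ∈ p.1.parts}) → Fin (p.1.parts.count i.1) :=
    { toFun := fun d => ⟨⟨d.1.partition, d.2⟩, d.1.designated⟩
      invFun := fun x => ⟨⟨x.1.1, x.2⟩, x.1.2⟩
      left_inv := fun _ => rfl
      right_inv := fun _ => rfl }
  have hprod (p : n.Partition) : (p.parts.toFinsupp.prod fun i c => if k ∣ i then 0 else c) =
      if IsRegularPartition k p then ∏ i ∈ p.parts.toFinset, p.parts.count i else 0 := by
    rw [Finsupp.prod, Multiset.toFinsupp_support]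
    split_ifs with h
    · refine prod_congr rfl fun i hi => ?_
      rw [if_neg (h i (Multiset.mem_toFinset.1 hi)), Multiset.toFinsupp_apply]
    · simp only [IsRegularPartition, not_forall, not_not] at h
      obtain ⟨i, hi, hki⟩ := h
      exact prod_eq_zero (Multiset.mem_toFinset.2 hi) (if_pos hki)
  have hfin (p : n.Partition) : Fintype {i : ℕ // i ∈ p.parts} :=
    Fintype.ofFinset p.parts.toFinset fun i => Multiset.mem_toFinset
  rw [PD, Nat.card_congr e, Nat.card_sigma, sum_congr rfl fun p _ => hprod p, ← sum_filter,
    Finset.sum_subtype (p := IsRegularPartition k) _ (by simp)]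
  refine sum_congr rfl fun p _ => ?_
  rw [Nat.card_pi]
  simp only [Nat.card_eq_fintype_card, Fintype.card_fin]
  exact (Finset.prod_subtype p.1.parts.toFinset (fun i => Multiset.mem_toFinset)
    fun i => p.1.parts.count i).symm

/-- The generating function of the numbers `PD 2 n`. -/
noncomputable def designatedOddSeries (R : Type*) [CommRing R] : R⟦X⟧ :=
  PowerSeries.mk fun n => (PD 2 n : R)

theorem designatedOddSeries_eq_genFun (R : Type*) [CommRing R] :
    designatedOddSeries R = Nat.Partition.genFun fun i c => if 2 ∣ i then 0 else (c : R) := by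
  ext n
  rw [designatedOddSeries, coeff_mk, Nat.Partition.coeff_genFun, PD_eq_sum, Nat.cast_sum]
  refine sum_congr rfl fun p _ => ?_
  simp only [Finsupp.prod, Nat.cast_prod, Nat.cast_ite, Nat.cast_zero]

section products

variable {R : Type*} [CommRing R] [TopologicalSpace R] [T2Space R] [IsTopologicalRing R]

theorem one_add_tsum_mul_pow_mul (k : ℕ) (hk : k ≠ 0) :
    (1 + ∑' j : ℕ, ((j + 1 : ℕ) : R) • (X : R⟦X⟧) ^ (k * (j + 1))) * (1 - X ^ k) ^ 2 =
      1 - X ^ k + (X ^ k) ^ 2 := by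
  set x : R⟦X⟧ := X ^ k with hx
  have hx0 : constantCoeff x = 0 := by simp [hx, hk]
  have hs : Summable fun j : ℕ => ((j + 1 : ℕ) : R) • (X : R⟦X⟧) ^ (k * (j + 1)) := by
    have := Nat.Partition.summable_genFun_term' (R := R) (fun _ c => (c : R)) hk
    exact this
  have hg := WithPiTopology.summable_pow_of_constantCoeff_eq_zero hx0
  -- With S = ∑ j x^j, this is S = xS + x/(1-x), whence S = x/(1-x)².
  have hshift : ∑' j : ℕ, ((j + 1 : ℕ) : R) • (X : R⟦X⟧) ^ (k * (j + 1)) =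
      x * (∑' j : ℕ, ((j + 1 : ℕ) : R) • (X : R⟦X⟧) ^ (k * (j + 1))) + x * ∑' j : ℕ, x ^ j := by
    have hx' (j : ℕ) : (X : R⟦X⟧) ^ (k * (j + 1)) = x * x ^ j := by rw [pow_mul, pow_succ']
    simp only [hx'] at hs ⊢
    have hsucc (j : ℕ) : ((j + 1 + 1 : ℕ) : R) • (x * x ^ (j + 1)) =
        x * (((j + 1 : ℕ) : R) • (x * x ^ j)) + x * x ^ (j + 1) := by
      rw [Nat.cast_add_one, add_smul, one_smul, mul_smul_comm, pow_succ']
    have hg' : Summable fun j : ℕ => x * x ^ (j + 1) := by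
      simpa only [pow_succ'] using (hg.mul_left x).mul_left x
    rw [← hg.tsum_mul_left, ← hs.tsum_mul_left, hs.tsum_eq_zero_add,
      (hg.mul_left x).tsum_eq_zero_add, tsum_congr hsucc, (hs.mul_left x).tsum_add hg']
    simp only [zero_add, Nat.cast_one, one_smul]
    abel
  have hgeom := WithPiTopology.tsum_pow_mul_one_sub_of_constantCoeff_eq_zero hx0
  linear_combination (1 - x) * hshift + x * hgeom

theorem designatedOddSeries_mul_odd :
    designatedOddSeries R *
      (oddEulerProduct R 1 * oddEulerProduct R 2 * oddEulerProduct R 3) =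
      oddEulerProduct R 6 := by
  have h := Nat.Partition.hasProd_genFun fun i c => if 2 ∣ i then 0 else (c : R)
  rw [← designatedOddSeries_eq_genFun] at h
  have hinj : Function.Injective fun n : ℕ => 2 * n := fun a b h => by simpa using h
  rw [← hinj.hasProd_iff] at h
  swap
  -- Index i stands for part size i+1, so indices outside the range of n ↦ 2n are even parts, with
  -- factor 1.
  · intro i hi
    have : 2 ∣ i + 1 := by
      by_contra h
      exact hi ⟨i / 2, by dsimp only; omega⟩
    simp [this]
  have h1 := (multipliable_oddEulerProduct (R := R) one_ne_zero).hasProd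
  have h2 := (multipliable_oddEulerProduct (R := R) two_ne_zero).hasProd
  have h3 := (multipliable_oddEulerProduct (R := R) three_ne_zero).hasProd
  refine (h.mul ((h1.mul h2).mul h3)).tprod_eq.symm.trans (tprod_congr fun n => ?_)
  have hn : ¬ 2 ∣ 2 * n + 1 := by omega
  have := one_add_tsum_mul_pow_mul (R := R) (2 * n + 1) (by omega)
  simp only [Function.comp_apply, hn, if_false, one_mul, pow_mul' _ _ (2 * n + 1)]
  set x : R⟦X⟧ := X ^ (2 * n + 1)
  -- (1-x)(1-x²)(1-x³) · (1-x+x²)/(1-x)² = (1+x³)(1-x³) = 1 - x⁶.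
  linear_combination (1 + x) * (1 - x ^ 3) * this

theorem designatedOddSeries_mul_eulerProduct :
    designatedOddSeries R * (eulerProduct R 1 * eulerProduct R 3 * eulerProduct R 12) =
      eulerProduct R 4 * eulerProduct R 6 ^ 2 := by
  have h1 := eulerProduct_eq_odd_mul (R := R) (k := 1) (by norm_num)
  have h2 := eulerProduct_eq_odd_mul (R := R) (k := 2) (by norm_num)
  have h3 := eulerProduct_eq_odd_mul (R := R) (k := 3) (by norm_num)
  have h6 := eulerProduct_eq_odd_mul (R := R) (k := 6) (by norm_num)
  norm_num at h1 h2 h3 h6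
  have h := designatedOddSeries_mul_odd (R := R)
  rw [h1, h3]
  nth_rw 1 [h2]
  rw [sq]
  nth_rw 2 [h6]
  linear_combination eulerProduct R 4 * eulerProduct R 6 * eulerProduct R 12 * h

/-! ### Congruences modulo 4 for F -/

/-- Inserting the products for ψ(q) and ψ(q²) in ψ² = φ ψ(q²) gives φ f_1² f_4² = f_2⁵; modulo 4,
f_4² = f_2⁴ cancels. -/
theorem phiSeries_mul_eulerProduct_sq (h4 : (4 : R⟦X⟧) = 0) :
    phiSeries R * eulerProduct R 1 ^ 2 = eulerProduct R 2 := by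
  have hψ := psiSeries_mul_eulerProduct (R := R)
  have hψ2 := congrArg (expand 2 two_ne_zero) hψ
  rw [map_mul, map_pow, expand_eulerProduct _ _ one_ne_zero,
    expand_eulerProduct _ _ two_ne_zero] at hψ2
  have hp := eulerProduct_pow_four h4 (R := R) (k := 2) (by norm_num)
  norm_num at hψ2 hp
  have hu : IsUnit (eulerProduct R 2 ^ 4) := (isUnit_eulerProduct two_ne_zero).pow 4
  refine hu.mul_right_cancel ?_
  have hs := psiSeries_sq R
  set ψ2 := expand 2 two_ne_zero (psiSeries R)
  linear_combination (phiSeries R * eulerProduct R 1 ^ 2) * hp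
    - phiSeries R * eulerProduct R 1 ^ 2 * hψ2
    - eulerProduct R 1 ^ 2 * eulerProduct R 2 * hs
    + eulerProduct R 2 * (psiSeries R * eulerProduct R 1 + eulerProduct R 2 ^ 2) * hψ

/-- The dissection of the generating function of `PD 2` modulo `4` by parity. -/
theorem designatedOddSeries_eq (h4 : (4 : R⟦X⟧) = 0) :
    designatedOddSeries R = expand 2 two_ne_zero (designatedOddSeries R ^ 2) +
      X * eulerProduct R 6 ^ 4 := by
  have ex (p : ℕ) (hp : p ≠ 0) {k : ℕ} (hk : k ≠ 0) := expand_eulerProduct (R := R) p hp hk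
  have u2 := isUnit_eulerProduct (R := R) (k := 2) (by norm_num)
  have u1 := isUnit_eulerProduct (R := R) (k := 1) (by norm_num)
  have u3 := isUnit_eulerProduct (R := R) (k := 3) (by norm_num)
  have u6 := isUnit_eulerProduct (R := R) (k := 6) (by norm_num)
  have u12 := isUnit_eulerProduct (R := R) (k := 12) (by norm_num)
  have u24 := isUnit_eulerProduct (R := R) (k := 24) (by norm_num)
  have p4 := eulerProduct_pow_four h4 (R := R) (k := 4) (by norm_num)
  have p6 := eulerProduct_pow_four h4 (R := R) (k := 6) (by norm_num)
  have p12 := eulerProduct_pow_four h4 (R := R) (k := 12) (by norm_num)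
  have ψ1 := psiSeries_mul_eulerProduct (R := R)
  have ψ3 := congrArg (expand 3 three_ne_zero) ψ1
  have ψ4 := congrArg (expand 4 four_ne_zero) ψ1
  have ψ12 := congrArg (expand 12 (by norm_num)) ψ1
  have φ1 := phiSeries_mul_eulerProduct_sq h4
  have φ2 := congrArg (expand 2 two_ne_zero) φ1
  have φ6 := congrArg (expand 6 (by norm_num)) φ1
  have s1 := phiSeries_sq_eq_one h4
  have s2 := congrArg (expand 2 two_ne_zero) s1
  have s6 := congrArg (expand 6 (by norm_num)) s1
  have lat := psiSeries_mul_expand_three R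
  have F1 := designatedOddSeries_mul_eulerProduct (R := R)
  have F2 := congrArg (expand 2 two_ne_zero) F1
  rw [map_mul, map_pow, ex _ _ one_ne_zero, ex _ _ two_ne_zero] at ψ3 ψ4 ψ12
  rw [map_mul, map_pow, ex _ _ one_ne_zero, ex _ _ two_ne_zero] at φ2 φ6
  rw [map_pow, map_one] at s2 s6
  rw [map_mul, map_mul, map_mul, map_mul, map_pow, ex _ _ (by norm_num), ex _ _ (by norm_num),
    ex _ _ (by norm_num), ex _ _ (by norm_num), ex _ _ (by norm_num)] at F2
  norm_num only at p4 p6 p12 ψ1 ψ3 ψ4 ψ12 φ1 φ2 φ6 F2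
  rw [map_pow]
  generalize designatedOddSeries R = F at *
  generalize expand 2 two_ne_zero F = G at *
  generalize expand 3 _ (psiSeries R) = Ψ3 at *
  generalize expand 4 _ (psiSeries R) = Ψ4 at *
  generalize expand 12 _ (psiSeries R) = Ψ12 at *
  generalize expand 2 _ (phiSeries R) = Φ2 at *
  generalize expand 6 _ (phiSeries R) = Φ6 at *
  generalize psiSeries R = Ψ at *
  generalize eulerProduct R 1 = f1 at *
  generalize eulerProduct R 2 = f2 at *
  generalize eulerProduct R 3 = f3 at *
  generalize eulerProduct R 4 = f4 at *
  generalize eulerProduct R 6 = f6 at *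
  generalize eulerProduct R 8 = f8 at *
  generalize eulerProduct R 12 = f12 at *
  generalize eulerProduct R 24 = f24 at *
  -- Substitute the dissection of ψ(q)ψ(q³), with ψ(q⁴) f_4 = f_8² = f_4⁴ and φ(q²) f_4 = φ(q²)²
  -- f_2² = f_2².
  have e1 : F * f12 * f2 ^ 2 = Φ6 * f4 ^ 4 + X * (f2 ^ 2 * Ψ12) := by
    refine (u1.mul u3).mul_right_cancel ?_
    linear_combination f2 ^ 2 * F1 - f4 * f6 ^ 2 * ψ1 - f4 * Ψ * f1 * ψ3
      + f1 * f3 * f4 * lat + f1 * f3 * Φ6 * (ψ4 - p4)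
      - X * f1 * f3 * Ψ12 * Φ2 * φ2 + X * f1 * f3 * f2 ^ 2 * Ψ12 * s2
  -- Multiplying by f_12 removes the remaining thetas: φ(q⁶) f_12 = f_6² and ψ(q¹²) f_12 = f_24² =
  -- f_12⁴.
  have e2 : F * f12 ^ 2 * f2 ^ 2 = f6 ^ 2 * f4 ^ 4 + X * (f2 ^ 2 * f12 ^ 4) := by
    linear_combination f12 * e1 - Φ6 * f4 ^ 4 * φ6 + f6 ^ 2 * f4 ^ 4 * s6
      + X * f2 ^ 2 * (ψ12 - p12)
  -- The even part just found is G² = F(q²)², by the eta quotient for F at q².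
  have e3 : G ^ 2 * f12 ^ 2 * f2 ^ 2 = f6 ^ 2 * f4 ^ 4 := by
    refine ((u6.pow 2).mul (u24.pow 2)).mul_right_cancel ?_
    linear_combination f12 ^ 2 * (G * (f2 * f6 * f24) + f8 * f12 ^ 2) * F2
      + f12 ^ 2 * f12 ^ 4 * (- p4) + f12 ^ 2 * f4 ^ 4 * p12 - f24 ^ 2 * f4 ^ 4 * p6
  refine ((u12.pow 2).mul (u2.pow 2)).mul_right_cancel ?_
  linear_combination e2 - e3 - X * f2 ^ 2 * f12 ^ 2 * p6

/-- F is an eta quotient, so f_k⁴ = f_(2k)² applies to each of its factors. -/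
theorem designatedOddSeries_pow_four (h4 : (4 : R⟦X⟧) = 0) :
    designatedOddSeries R ^ 4 = expand 2 two_ne_zero (designatedOddSeries R ^ 2) := by
  have ex (p : ℕ) (hp : p ≠ 0) {k : ℕ} (hk : k ≠ 0) := expand_eulerProduct (R := R) p hp hk
  have F1 := designatedOddSeries_mul_eulerProduct (R := R)
  have F2 := congrArg (expand 2 two_ne_zero) F1
  rw [map_mul, map_mul, map_mul, map_mul, map_pow, ex _ _ (by norm_num), ex _ _ (by norm_num),
    ex _ _ (by norm_num), ex _ _ (by norm_num), ex _ _ (by norm_num)] at F2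
  have p (k : ℕ) (hk : k ≠ 0) := eulerProduct_pow_four h4 (R := R) hk
  have p1 := p 1 (by norm_num)
  have p3 := p 3 (by norm_num)
  have p4 := p 4 (by norm_num)
  have p6 := p 6 (by norm_num)
  have p12 := p 12 (by norm_num)
  have u (k : ℕ) (hk : k ≠ 0) := isUnit_eulerProduct (R := R) hk
  refine ((((u 2 (by norm_num)).mul (u 6 (by norm_num))).mul
    (u 24 (by norm_num))).pow 2).mul_right_cancel ?_
  rw [map_pow, ← mul_pow, F2, mul_pow, mul_pow]
  norm_num only at p1 p3 p4 p6 p12 ⊢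
  rw [← p1, ← p3, ← p12, ← mul_pow, ← mul_pow, ← mul_pow, F1, mul_pow, p4, mul_pow, ← p6]
  ring

end products

/-! ### Extraction of coefficients -/

theorem four_eq_zero_zmodSeries : (4 : (ZMod 4)⟦X⟧) = 0 := by
  rw [← map_ofNat (C (R := ZMod 4)) 4, show (OfNat.ofNat 4 : ZMod 4) = 0 by decide, map_zero]

theorem PD_two_four_mul (n : ℕ) : (PD 2 (4 * n) : ZMod 4) = PD 2 n := by
  have h4 := four_eq_zero_zmodSeries
  have hF := designatedOddSeries_eq h4
  have hF4 := designatedOddSeries_pow_four h4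
  set F := designatedOddSeries (ZMod 4) with hFdef
  have hE3 : eulerProduct (ZMod 4) 6 ^ 4 =
      expand 2 two_ne_zero (eulerProduct (ZMod 4) 3 ^ 4) := by
    rw [map_pow, expand_eulerProduct _ _ three_ne_zero]
  have hE38 : (eulerProduct (ZMod 4) 3 ^ 4) ^ 2 = eulerProduct (ZMod 4) 6 ^ 4 := by
    rw [eulerProduct_pow_four h4 three_ne_zero, ← pow_mul]
  -- The even part of F² is F⁴ + q f_3⁸ evaluated at q², and F⁴ + q f_3⁸ = F(q²)² + q f_6⁴ = F.
  have hsq : F ^ 2 = expand 2 two_ne_zero F +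
      X * expand 2 two_ne_zero (2 * F ^ 2 * eulerProduct (ZMod 4) 3 ^ 4) := by
    conv_lhs => rw [hF, hE3]
    conv_rhs => enter [1]; rw [hF, ← hF4, ← hE38]
    simp only [map_add, map_mul, map_pow, map_ofNat, expand_X]
    ring
  have hcoeff (m : ℕ) : (PD 2 m : ZMod 4) = F.coeff m := by
    rw [hFdef, designatedOddSeries, coeff_mk]
  have heven (A B : (ZMod 4)⟦X⟧) (m : ℕ) :
      (expand 2 two_ne_zero A + X * expand 2 two_ne_zero B).coeff (2 * m) = A.coeff m := by
    rw [map_add, coeff_expand_mul]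
    cases m with
    | zero => simp
    | succ m =>
      rw [show 2 * (m + 1) = 2 * m + 1 + 1 by ring, coeff_succ_X_mul,
        coeff_expand_of_not_dvd _ _ _ (by omega), add_zero]
  have hhalf (m : ℕ) : F.coeff (2 * m) = (F ^ 2).coeff m := by
    conv_lhs => rw [hF, hE3]
    exact heven _ _ m
  rw [hcoeff, hcoeff, show 4 * n = 2 * (2 * n) by ring, hhalf, hsq, heven]

theorem PD_two_six_mul_add_five (n : ℕ) : (PD 2 (6 * n + 5) : ZMod 4) = 0 := by
  have h := congrArg (coeff (6 * n + 5)) (designatedOddSeries_eq four_eq_zero_zmodSeries)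
  rw [designatedOddSeries, coeff_mk, map_add, coeff_expand_of_not_dvd _ _ _ (by omega), zero_add,
    coeff_succ_X_mul] at h
  -- f_6⁴ is a series in q⁶, while the exponent left after removing q is 6n + 4.
  rw [h, show eulerProduct (ZMod 4) 6 = expand 6 (by norm_num) (eulerProduct (ZMod 4) 1) by
    rw [expand_eulerProduct _ _ one_ne_zero, mul_one],
    ← map_pow, coeff_expand_of_not_dvd _ _ _ (by omega)]

theorem mainTheorem5 (α n : ℕ) : PD 2 (4 ^ α * (6 * n + 5)) ≡ 0 [MOD 4] := by
  rw [← ZMod.natCast_eq_natCast_iff, Nat.cast_zero]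
  induction α with
  | zero => rw [pow_zero, one_mul, PD_two_six_mul_add_five]
  | succ α ih => rw [pow_succ', mul_assoc, PD_two_four_mul, ih]
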